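/- For positive integers $p,q,n$ let $C_{p,q,n}$ be the group with presentation $$\langle P,Q \mid P^p=Q^q=(PQ)^n=1,\ P^2Q=QP^2,\ PQ^2=Q^2P\rangle .$$ Write $(a,b)$ for the greatest common divisor and $[a,b]$ for the least common multiple, and put $p'=(p,[q,2n])$, $q'=(q,[p,2n])$. (1) Suppose that $PQ\neq QP$ in $C_{p,q,n}$ (so that $C_{p,q,n}$ is a chain group). Then: - $p$ and $q$ are even, and $P^{2n}Q^{2n}=1$; - $C_{p,q,n}=C_{p',q',n}$, that is, there is an isomorphism $C_{p,q,n}\to C_{p',q',n}$ taking $P$ to $P$ and $Q$ to $Q$; - it is not the case that $n=2$ and $p'=q'\equiv 2\pmod 4$; - $C_{p,q,n}$ is finite, of order $|C_{p,q,n}|=p'\,(q',2n)\,n/2$; - the abelian subgroup $S=\langle P^2,Q^2\rangle$ is central, of order $|S|=p'\,(q',2n)/4$, and $C_{p,q,n}/S\cong D_n$, the dihedral group of order $2n$. (2) Conversely, if $p$ and $q$ are even, $n\ge 2$, and it is not the case that $n=2$ and $p'=q'\equiv 2\pmod 4$, then $PQ\neq QP$ in $C_{p,q,n}$. -/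

import Mathlib

namespace ChainGroup

/-- The defining relators, in the free group on the two letters `0` (for `P`) and `1` (for `Q`):
`P ^ p`, `Q ^ q`, `(P Q) ^ n`, and the relations `P² Q = Q P²` and `P Q² = Q² P`. -/
def rels (p q n : ℕ) : Set (FreeGroup (Fin 2)) :=
  let P := FreeGroup.of (0 : Fin 2)
  let Q := FreeGroup.of (1 : Fin 2)
  {P ^ p, Q ^ q, (P * Q) ^ n, (P ^ 2 * Q) * (Q * P ^ 2)⁻¹, (P * Q ^ 2) * (Q ^ 2 * P)⁻¹}

/-- The group `⟨P, Q | P^p = Q^q = (PQ)^n = 1, P²Q = QP², PQ² = Q²P⟩`. The requirement `PQ ≠ QP`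
is not a relation; it is a condition on the parameters, imposed on this group. -/
abbrev C (p q n : ℕ) : Type := PresentedGroup (rels p q n)

/-- The generator `P`. -/
def P (p q n : ℕ) : C p q n := PresentedGroup.of 0

/-- The generator `Q`. -/
def Q (p q n : ℕ) : C p q n := PresentedGroup.of 1

/-- The subgroup `S = ⟨P², Q²⟩`. -/
def S (p q n : ℕ) : Subgroup (C p q n) :=
  Subgroup.closure {P p q n ^ 2, Q p q n ^ 2}

/-- `p' = (p, [q, 2n])`; the number `q' = (q, [p, 2n])` is `reduced q p n`. -/
def reduced (p q n : ℕ) : ℕ := Nat.gcd p (Nat.lcm q (2 * n))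

end ChainGroup

/-! Since `P²` and `Q²` are central, `QP = (PQ)⁻¹P²Q²`; its `n`-th power gives `P^(2n) Q^(2n) = 1`,
which allows `p`, `q` to be replaced by `p'`, `q'`. For even `p`, `q`, killing `S` leaves two
involutions with product of order `n`, so `|C| = 2n|S|` (`exists_dihedral_hom`).

It remains to find `S`. With `p = 2α`, `q = 2β`, it is a quotient of the abelian group `A` on `x =
P²`, `y = Q²` with `αx = βy = n(x + y) = 0`. No further relation holds: an explicit extension
`Model` of `ℤ/2` by `A × ℤ/n` satisfies the relators (`exists_model_hom`), so `|S| = |A|` (`card_S`,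
`card_A`). In the model `PQ = QP` forces `n ∣ 2` and `x + y = 0`; for `n = 2` the latter is exactly
the excluded case. -/

namespace ChainGroup

/-! ### Consequences of the relators; centrality of `S` -/

section Relations

variable (p q n : ℕ)

theorem P_pow : P p q n ^ p = 1 :=
  PresentedGroup.one_of_mem (rels := rels p q n) (by simp [rels])

theorem Q_pow : Q p q n ^ q = 1 :=
  PresentedGroup.one_of_mem (rels := rels p q n) (x := FreeGroup.of 1 ^ q) (by simp [rels])

theorem PQ_pow : (P p q n * Q p q n) ^ n = 1 :=
  PresentedGroup.one_of_mem (rels := rels p q n) (x := (FreeGroup.of 0 * FreeGroup.of 1) ^ n)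
    (by simp [rels])

theorem sq_P_mul_Q : P p q n ^ 2 * Q p q n = Q p q n * P p q n ^ 2 :=
  mul_inv_eq_one.mp <| PresentedGroup.one_of_mem (rels := rels p q n)
    (x := (FreeGroup.of 0 ^ 2 * FreeGroup.of 1) * (FreeGroup.of 1 * FreeGroup.of 0 ^ 2)⁻¹)
    (by simp [rels])

theorem P_mul_sq_Q : P p q n * Q p q n ^ 2 = Q p q n ^ 2 * P p q n :=
  mul_inv_eq_one.mp <| PresentedGroup.one_of_mem (rels := rels p q n)
    (x := (FreeGroup.of 0 * FreeGroup.of 1 ^ 2) * (FreeGroup.of 1 ^ 2 * FreeGroup.of 0)⁻¹)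
    (by simp [rels])

variable {p q n}

/-- A pair of elements satisfying the defining relations determines a homomorphism. -/
theorem exists_hom {G : Type*} [Group G] (x y : G) (hx : x ^ p = 1) (hy : y ^ q = 1)
    (hxy : (x * y) ^ n = 1) (h₁ : x ^ 2 * y = y * x ^ 2) (h₂ : x * y ^ 2 = y ^ 2 * x) :
    ∃ f : C p q n →* G, f (P p q n) = x ∧ f (Q p q n) = y := by
  refine ⟨PresentedGroup.toGroup (f := ![x, y]) (rels := rels p q n) ?_, ?_, ?_⟩
  · intro r hr
    simp only [rels, Set.mem_insert_iff, Set.mem_singleton_iff] at hr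
    rcases hr with rfl | rfl | rfl | rfl | rfl
    · simpa using hx
    · simpa using hy
    · simpa using hxy
    · rw [map_mul, map_inv, mul_inv_eq_one]; simpa using h₁
    · rw [map_mul, map_inv, mul_inv_eq_one]; simpa using h₂
  · simp [P]
  · simp [Q]

theorem hom_ext {G : Type*} [Group G] {f g : C p q n →* G} (hP : f (P p q n) = g (P p q n))
    (hQ : f (Q p q n) = g (Q p q n)) : f = g := by
  apply PresentedGroup.ext
  intro i
  fin_cases i
  · exact hP
  · exact hQ

theorem closure_generators : Subgroup.closure {P p q n, Q p q n} = ⊤ := by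
  rw [← PresentedGroup.closure_range_of (rels p q n)]
  congr 1
  ext x
  simp [P, Q, eq_comm]

theorem mem_center_of_commute {z : C p q n} (hP : Commute z (P p q n))
    (hQ : Commute z (Q p q n)) : z ∈ Subgroup.center (C p q n) := by
  rw [← Subgroup.centralizer_univ, ← Subgroup.coe_top, ← closure_generators,
    Subgroup.centralizer_closure, Subgroup.mem_centralizer_iff]
  intro x hx
  rcases hx with rfl | rfl
  exacts [hP.eq.symm, hQ.eq.symm]

theorem sq_P_mem_center : P p q n ^ 2 ∈ Subgroup.center (C p q n) :=
  mem_center_of_commute ((Commute.refl _).pow_left 2) (sq_P_mul_Q p q n)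

theorem sq_Q_mem_center : Q p q n ^ 2 ∈ Subgroup.center (C p q n) :=
  mem_center_of_commute (P_mul_sq_Q p q n).symm ((Commute.refl _).pow_left 2)

theorem S_le_center : S p q n ≤ Subgroup.center (C p q n) := by
  rw [S, Subgroup.closure_le]
  rintro x (rfl | rfl)
  exacts [sq_P_mem_center, sq_Q_mem_center]

theorem sq_P_commute (z : C p q n) : Commute (P p q n ^ 2) z :=
  (Subgroup.mem_center_iff.mp sq_P_mem_center z).symm

theorem sq_Q_commute (z : C p q n) : Commute (Q p q n ^ 2) z :=
  (Subgroup.mem_center_iff.mp sq_Q_mem_center z).symm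

theorem PQ_mul_QP : P p q n * Q p q n * (Q p q n * P p q n) = P p q n ^ 2 * Q p q n ^ 2 := by
  have h := (sq_Q_commute (P p q n)).eq
  calc _ = P p q n * (Q p q n ^ 2 * P p q n) := by simp only [pow_two, mul_assoc]
    _ = _ := by rw [h]; simp only [pow_two, mul_assoc]

theorem QP_eq : Q p q n * P p q n = (P p q n * Q p q n)⁻¹ * (P p q n ^ 2 * Q p q n ^ 2) := by
  rw [← PQ_mul_QP, inv_mul_cancel_left]

theorem QP_pow : (Q p q n * P p q n) ^ n = 1 := by
  have h : Q p q n * P p q n = (P p q n)⁻¹ * (P p q n * Q p q n) * (P p q n)⁻¹⁻¹ := by group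
  rw [h, conj_pow, PQ_pow]; simp

theorem P_pow_mul_Q_pow : P p q n ^ (2 * n) * Q p q n ^ (2 * n) = 1 := by
  have h := congrArg (· ^ n) (QP_eq (p := p) (q := q) (n := n))
  have hc : Commute (P p q n * Q p q n)⁻¹ (P p q n ^ 2 * Q p q n ^ 2) :=
    ((sq_P_commute _).mul_left (sq_Q_commute _)).symm
  simp only [QP_pow, hc.mul_pow, inv_pow, PQ_pow, (sq_P_commute (Q p q n ^ 2)).mul_pow,
    ← pow_mul] at h
  simpa using h.symm

/-- If `p` is odd, `P` is a power of the central element `P²` up to inversion; likewise for `Q`. -/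
theorem even_of_not_commute (h : P p q n * Q p q n ≠ Q p q n * P p q n) : Even p ∧ Even q := by
  constructor <;> by_contra! hodd <;> rw [Nat.not_even_iff_odd] at hodd <;>
    obtain ⟨k, rfl⟩ := hodd <;> apply h
  · have h1 : P (2 * k + 1) q n = ((P (2 * k + 1) q n ^ 2) ^ k)⁻¹ := by
      have := P_pow (2 * k + 1) q n
      rw [pow_succ, pow_mul] at this
      exact eq_inv_of_mul_eq_one_right this
    have := ((sq_P_commute (Q (2 * k + 1) q n)).pow_left k).inv_left
    rw [← h1] at this
    exact this
  · have h1 : Q p (2 * k + 1) n = ((Q p (2 * k + 1) n ^ 2) ^ k)⁻¹ := by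
      have := Q_pow p (2 * k + 1) n
      rw [pow_succ, pow_mul] at this
      exact eq_inv_of_mul_eq_one_right this
    have := ((sq_Q_commute (P p (2 * k + 1) n)).pow_left k).inv_left
    rw [← h1] at this
    exact this.symm

end Relations

/-! ### Replacing `p`, `q` by `p'`, `q'` -/

section Reduction

variable {p q n : ℕ}

theorem pow_lcm_eq_one {G : Type*} [Group G] {x y : G} {q m : ℕ} (hy : y ^ q = 1)
    (h : x ^ m * y ^ m = 1) : x ^ Nat.lcm q m = 1 := by
  obtain ⟨k, hk⟩ := Nat.dvd_lcm_right q m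
  obtain ⟨l, hl⟩ := Nat.dvd_lcm_left q m
  rw [hk, pow_mul, eq_inv_of_mul_eq_one_left h, inv_pow, ← pow_mul, ← hk, hl, pow_mul, hy]
  simp

theorem P_pow_reduced : P p q n ^ reduced p q n = 1 := by
  rw [← orderOf_dvd_iff_pow_eq_one]
  exact Nat.dvd_gcd (orderOf_dvd_of_pow_eq_one (P_pow p q n))
    (orderOf_dvd_of_pow_eq_one (pow_lcm_eq_one (Q_pow p q n) P_pow_mul_Q_pow))

theorem Q_pow_reduced : Q p q n ^ reduced q p n = 1 := by
  rw [← orderOf_dvd_iff_pow_eq_one]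
  refine Nat.dvd_gcd (orderOf_dvd_of_pow_eq_one (Q_pow p q n))
    (orderOf_dvd_of_pow_eq_one (pow_lcm_eq_one (P_pow p q n) ?_))
  rw [mul_eq_one_iff_eq_inv', ← mul_eq_one_iff_eq_inv]
  exact P_pow_mul_Q_pow

theorem exists_equiv_reduced :
    ∃ e : C p q n ≃* C (reduced p q n) (reduced q p n) n,
      e (P p q n) = P (reduced p q n) (reduced q p n) n ∧
      e (Q p q n) = Q (reduced p q n) (reduced q p n) n := by
  obtain ⟨f, fP, fQ⟩ := exists_hom (p := p) (q := q) (n := n)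
    (P (reduced p q n) (reduced q p n) n) (Q (reduced p q n) (reduced q p n) n)
    (orderOf_dvd_iff_pow_eq_one.mp
      ((orderOf_dvd_of_pow_eq_one (P_pow _ _ _)).trans (Nat.gcd_dvd_left _ _)))
    (orderOf_dvd_iff_pow_eq_one.mp
      ((orderOf_dvd_of_pow_eq_one (Q_pow _ _ _)).trans (Nat.gcd_dvd_left _ _)))
    (PQ_pow _ _ _) (sq_P_mul_Q _ _ _) (P_mul_sq_Q _ _ _)
  obtain ⟨g, gP, gQ⟩ := exists_hom (p := reduced p q n) (q := reduced q p n) (n := n)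
    (P p q n) (Q p q n) P_pow_reduced Q_pow_reduced
    (PQ_pow _ _ _) (sq_P_mul_Q _ _ _) (P_mul_sq_Q _ _ _)
  exact ⟨f.toMulEquiv g (hom_ext (by simp [fP, gP]) (by simp [fQ, gQ]))
    (hom_ext (by simp [fP, gP]) (by simp [fQ, gQ])), fP, fQ⟩

end Reduction

/-! ### The dihedral quotient by `S` -/

section Dihedral

variable {p q n : ℕ}

theorem exists_normal_form (g : C p q n) : ∃ s ∈ S p q n, ∃ k : ℤ,
    g = s * (P p q n * Q p q n) ^ k ∨ g = s * (P p q n * Q p q n) ^ k * P p q n := by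
  have ha : P p q n ^ 2 ∈ S p q n := Subgroup.subset_closure (by simp)
  have hb : Q p q n ^ 2 ∈ S p q n := Subgroup.subset_closure (by simp)
  have stepP : ∀ g : C p q n, (∃ s ∈ S p q n, ∃ k : ℤ,
      g = s * (P p q n * Q p q n) ^ k ∨ g = s * (P p q n * Q p q n) ^ k * P p q n) →
      ∃ s ∈ S p q n, ∃ k : ℤ, g * P p q n = s * (P p q n * Q p q n) ^ k ∨
        g * P p q n = s * (P p q n * Q p q n) ^ k * P p q n := by
    rintro g ⟨s, hs, k, rfl | rfl⟩
    · exact ⟨s, hs, k, .inr rfl⟩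
    · refine ⟨s * P p q n ^ 2, mul_mem hs ha, k, .inl ?_⟩
      rw [mul_assoc s (P p q n ^ 2), (sq_P_commute _).eq, pow_two]
      simp only [mul_assoc]
  have stepQ : ∀ g : C p q n, (∃ s ∈ S p q n, ∃ k : ℤ,
      g = s * (P p q n * Q p q n) ^ k ∨ g = s * (P p q n * Q p q n) ^ k * P p q n) →
      ∃ s ∈ S p q n, ∃ k : ℤ, g * Q p q n = s * (P p q n * Q p q n) ^ k ∨
        g * Q p q n = s * (P p q n * Q p q n) ^ k * P p q n := by
    rintro g ⟨s, hs, k, rfl | rfl⟩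
    -- `(PQ)^k Q = (PQ)^(k-1) P Q²`, and `Q²` moves into `s`.
    · refine ⟨s * Q p q n ^ 2, mul_mem hs hb, k - 1, .inr ?_⟩
      rw [mul_assoc s (Q p q n ^ 2), (sq_Q_commute _).eq, zpow_sub_one]
      simp only [mul_assoc, pow_two]
      have := (sq_Q_commute (P p q n)).eq
      simp only [pow_two, mul_assoc] at this
      rw [this]
      group
    · refine ⟨s, hs, k + 1, .inl ?_⟩
      rw [zpow_add_one]
      simp only [mul_assoc]
  have mulS : ∀ t ∈ S p q n, ∀ g : C p q n, (∃ s ∈ S p q n, ∃ k : ℤ,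
      g = s * (P p q n * Q p q n) ^ k ∨ g = s * (P p q n * Q p q n) ^ k * P p q n) →
      ∃ s ∈ S p q n, ∃ k : ℤ, t * g = s * (P p q n * Q p q n) ^ k ∨
        t * g = s * (P p q n * Q p q n) ^ k * P p q n := by
    rintro t ht g ⟨s, hs, k, h⟩
    refine ⟨t * s, mul_mem ht hs, k, h.imp ?_ ?_⟩ <;> rintro rfl <;> simp only [mul_assoc]
  have hg : g ∈ Subgroup.closure {P p q n, Q p q n} := by rw [closure_generators]; trivial
  induction hg using Subgroup.closure_induction_right with
  | one => exact ⟨1, one_mem _, 0, .inl (by simp)⟩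
  | mul_right x _ y hy ih =>
    rcases hy with rfl | rfl
    exacts [stepP _ ih, stepQ _ ih]
  | mul_inv_cancel x _ y hy ih =>
    rcases hy with rfl | rfl
    · have h : x * (P p q n)⁻¹ = (P p q n ^ 2)⁻¹ * (x * P p q n) := by
        rw [((sq_P_commute (x * P p q n)).inv_left).eq]; group
      rw [h]
      exact mulS _ (inv_mem ha) _ (stepP _ ih)
    · have h : x * (Q p q n)⁻¹ = (Q p q n ^ 2)⁻¹ * (x * Q p q n) := by
        rw [((sq_Q_commute (x * Q p q n)).inv_left).eq]; group
      rw [h]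
      exact mulS _ (inv_mem hb) _ (stepQ _ ih)

theorem PQ_zpow_eq_one {k : ℤ} (h : (k : ZMod n) = 0) : (P p q n * Q p q n) ^ k = 1 := by
  obtain ⟨m, rfl⟩ := (ZMod.intCast_zmod_eq_zero_iff_dvd _ _).mp h
  rw [zpow_mul, zpow_natCast, PQ_pow, one_zpow]

theorem exists_dihedral_hom (hp : Even p) (hq : Even q) :
    ∃ f : C p q n →* DihedralGroup n, Function.Surjective f ∧ f.ker = S p q n := by
  have hsr : ∀ i : ZMod n, (DihedralGroup.sr i) ^ 2 = 1 := fun i ↦ by simp [pow_two]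
  obtain ⟨f, fP, fQ⟩ := exists_hom (p := p) (q := q) (n := n)
    (DihedralGroup.sr (0 : ZMod n)) (DihedralGroup.sr (1 : ZMod n))
    (by obtain ⟨k, rfl⟩ := hp; rw [← two_mul, pow_mul, hsr, one_pow])
    (by obtain ⟨k, rfl⟩ := hq; rw [← two_mul, pow_mul, hsr, one_pow])
    (by simp) (by simp [hsr]) (by simp [hsr])
  have fc (k : ℤ) : f ((P p q n * Q p q n) ^ k) = DihedralGroup.r (k : ZMod n) := by
    rw [map_zpow, map_mul, fP, fQ, DihedralGroup.sr_mul_sr, sub_zero]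
    simp
  refine ⟨f, ?_, ?_⟩
  · rintro (i | i)
    · obtain ⟨k, rfl⟩ := ZMod.intCast_surjective i
      exact ⟨_, fc k⟩
    · obtain ⟨k, rfl⟩ := ZMod.intCast_surjective i
      refine ⟨P p q n * (P p q n * Q p q n) ^ k, ?_⟩
      rw [map_mul, fc, fP]
      simp
  · have hle : S p q n ≤ f.ker := by
      rw [S, Subgroup.closure_le]
      rintro x (rfl | rfl)
      · simp [MonoidHom.mem_ker, fP, hsr]
      · simp [MonoidHom.mem_ker, fQ, hsr]
    refine le_antisymm (fun g hg ↦ ?_) hle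
    obtain ⟨s, hs, k, rfl | rfl⟩ := exists_normal_form g
    · rw [MonoidHom.mem_ker, map_mul, hle hs, one_mul, fc, DihedralGroup.one_def,
        DihedralGroup.r.injEq] at hg
      rwa [PQ_zpow_eq_one hg, mul_one]
    · rw [MonoidHom.mem_ker, map_mul, map_mul, hle hs, one_mul, fc, fP, DihedralGroup.one_def,
        DihedralGroup.r_mul_sr] at hg
      cases hg

end Dihedral

/-! ### The abelian group `A` and its order -/

section Lattice

/-- The lattice of exponents `(i, j)` with `P ^ (2 * i) * Q ^ (2 * j) = 1`, where `p = 2 * α` and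
`q = 2 * β`. -/
def lattice (α β n : ℕ) : AddSubgroup (ℤ × ℤ) where
  carrier := {z | ∃ u v w : ℤ, z = (u * n + v * α, u * n + w * β)}
  zero_mem' := ⟨0, 0, 0, by simp; rfl⟩
  add_mem' := by
    rintro _ _ ⟨u, v, w, rfl⟩ ⟨u', v', w', rfl⟩
    exact ⟨u + u', v + v', w + w', by ext <;> simp <;> ring⟩
  neg_mem' := by
    rintro _ ⟨u, v, w, rfl⟩
    exact ⟨-u, -v, -w, by ext <;> simp <;> ring⟩

theorem mem_lattice {α β n : ℕ} {i j : ℤ} : (i, j) ∈ lattice α β n ↔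
    ∃ u v w : ℤ, i = u * n + v * α ∧ j = u * n + w * β := by
  change (∃ u v w : ℤ, (i, j) = (u * n + v * α, u * n + w * β)) ↔ _
  simp only [Prod.mk.injEq]

/-- A vanishing second coordinate makes `u * n = -w * β` a common multiple of `n` and `β`, so the
first ranges over `αℤ + lcm(n, β)ℤ`. This gives the order of `(1, 0)` in `A`. -/
theorem mk_zero_mem_lattice {α β n : ℕ} {k : ℤ} :
    (k, 0) ∈ lattice α β n ↔ (Nat.gcd α (Nat.lcm n β) : ℤ) ∣ k := by
  rw [mem_lattice]
  constructor
  · rintro ⟨u, v, w, rfl, h⟩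
    refine dvd_add ?_ ((Int.natCast_dvd_natCast.mpr (Nat.gcd_dvd_left _ _)).mul_left _)
    refine (Int.natCast_dvd_natCast.mpr (Nat.gcd_dvd_right α (Nat.lcm n β))).trans ?_
    rw [← Int.lcm_natCast_natCast]
    exact Int.coe_lcm_dvd (dvd_mul_left _ _) ⟨-w, by linarith⟩
  · rintro ⟨t, rfl⟩
    obtain ⟨k, hk⟩ := Nat.dvd_lcm_left n β
    obtain ⟨l, hl⟩ := Nat.dvd_lcm_right n β
    have hk' : (Nat.lcm n β : ℤ) = n * k := by exact_mod_cast hk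
    have hl' : (Nat.lcm n β : ℤ) = β * l := by exact_mod_cast hl
    have hb := Nat.gcd_eq_gcd_ab α (Nat.lcm n β)
    set s := Nat.gcdA α (Nat.lcm n β)
    set r := Nat.gcdB α (Nat.lcm n β)
    refine ⟨k * r * t, s * t, -(l * r * t), ?_, ?_⟩
    · rw [hb, hk']; ring
    · linear_combination (r * t) * (hl'.symm.trans hk')

/-- The abelian group presented by `n • (x + y) = 0`, `α • x = 0`, `β • y = 0`. -/
abbrev A (α β n : ℕ) : Type := (ℤ × ℤ) ⧸ lattice α β n

variable {α β n : ℕ}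

theorem mk_eq_zero_iff {i j : ℤ} : ((i, j) : A α β n) = 0 ↔
    ∃ u v w : ℤ, i = u * n + v * α ∧ j = u * n + w * β := by
  rw [QuotientAddGroup.eq_zero_iff, mem_lattice]

/-- The second coordinate maps `A` onto `ℤ/gcd(n, β)`, with kernel generated by the class of `(1,
0)`. -/
theorem card_A (hn : 0 < n) :
    Nat.card (A α β n) = Nat.gcd α (Nat.lcm n β) * Nat.gcd n β := by
  have : NeZero (Nat.gcd n β) := ⟨(Nat.gcd_pos_of_pos_left _ hn).ne'⟩
  let π : A α β n →+ ZMod (Nat.gcd n β) := QuotientAddGroup.lift _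
    ((Int.castAddHom _).comp (AddMonoidHom.snd ℤ ℤ)) (by
      rintro ⟨i, j⟩ h
      obtain ⟨u, v, w, -, rfl⟩ := mem_lattice.mp h
      simp only [AddMonoidHom.mem_ker, AddMonoidHom.comp_apply, AddMonoidHom.coe_snd,
        Int.coe_castAddHom]
      rw [ZMod.intCast_zmod_eq_zero_iff_dvd]
      exact dvd_add ((Int.natCast_dvd_natCast.mpr (Nat.gcd_dvd_left _ _)).mul_left _)
        ((Int.natCast_dvd_natCast.mpr (Nat.gcd_dvd_right _ _)).mul_left _))
  have hπ (i j : ℤ) : π ((i, j) : ℤ × ℤ) = (j : ZMod (Nat.gcd n β)) := rfl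
  have hsurj : Function.Surjective π := fun x ↦ by
    obtain ⟨j, rfl⟩ := ZMod.intCast_surjective x
    exact ⟨((0, j) : ℤ × ℤ), hπ 0 j⟩
  have hker : π.ker = AddSubgroup.zmultiples (((1, 0) : ℤ × ℤ) : A α β n) := by
    ext z
    obtain ⟨⟨i, j⟩, rfl⟩ := QuotientAddGroup.mk_surjective z
    rw [AddMonoidHom.mem_ker, hπ, ZMod.intCast_zmod_eq_zero_iff_dvd,
      AddSubgroup.mem_zmultiples_iff]
    constructor
    · rintro ⟨t, rfl⟩
      -- Bézout for `gcd(n, β)` puts `(n * gcdA * t, j)` in the lattice; subtracting it clears `j`.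
      refine ⟨i - n * Nat.gcdA n β * t, ?_⟩
      rw [← QuotientAddGroup.mk_zsmul, QuotientAddGroup.eq, Prod.smul_mk, Prod.neg_mk,
        Prod.mk_add_mk, mem_lattice]
      refine ⟨Nat.gcdA n β * t, 0, Nat.gcdB n β * t, ?_, ?_⟩
      · simp; ring
      · rw [Nat.gcd_eq_gcd_ab n β]; simp; ring
    · rintro ⟨k, hk⟩
      rw [← QuotientAddGroup.mk_zsmul, QuotientAddGroup.eq, Prod.smul_mk, Prod.neg_mk,
        Prod.mk_add_mk, mem_lattice] at hk
      obtain ⟨u, v, w, -, hj⟩ := hk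
      have hj' : j = u * n + w * β := by simpa using hj
      rw [hj']
      exact dvd_add ((Int.natCast_dvd_natCast.mpr (Nat.gcd_dvd_left _ _)).mul_left _)
        ((Int.natCast_dvd_natCast.mpr (Nat.gcd_dvd_right _ _)).mul_left _)
  have hord : addOrderOf (((1, 0) : ℤ × ℤ) : A α β n) = Nat.gcd α (Nat.lcm n β) := by
    refine Nat.dvd_right_iff_eq.mp fun k ↦ ?_
    rw [addOrderOf_dvd_iff_nsmul_eq_zero, ← QuotientAddGroup.mk_nsmul,
      QuotientAddGroup.eq_zero_iff, ← Int.natCast_dvd_natCast, ← mk_zero_mem_lattice]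
    simp
  rw [← hord, ← Nat.card_zmultiples, ← hker, ← AddSubgroup.card_mul_index π.ker,
    AddSubgroup.index_ker, AddMonoidHom.range_eq_top.mpr hsurj, AddSubgroup.card_top,
    Nat.card_zmod]

end Lattice

/-! ### A concrete extension detecting `S` and noncommutativity -/

section Model

/-- The elements `u * c ^ k * P ^ ε` of the extension of `ℤ/2` by `B × ℤ/n` in which `P ^ 2 = x`
and conjugation by `P` takes the generator `c` of `ℤ/n` to `c⁻¹ * x * y`, where `f` is the
homomorphism taking `1` to `x + y`. -/
@[ext]
structure Model {B : Type*} [AddCommGroup B] {n : ℕ} (x : B) (f : ZMod n →+ B) where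
  /-- The component in `B`. -/
  u : B
  /-- The exponent of `c`. -/
  k : ZMod n
  /-- The parity of the exponent of `P`. -/
  odd : Bool

namespace Model

variable {B : Type*} [AddCommGroup B] {n : ℕ} {x : B} {f : ZMod n →+ B}

instance : Mul (Model x f) where
  mul
    | ⟨u, k, false⟩, ⟨v, l, ε⟩ => ⟨u + v, k + l, ε⟩
    | ⟨u, k, true⟩, ⟨v, l, false⟩ => ⟨u + v + f l, k - l, true⟩
    | ⟨u, k, true⟩, ⟨v, l, true⟩ => ⟨u + v + f l + x, k - l, false⟩

instance : One (Model x f) := ⟨⟨0, 0, false⟩⟩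

instance : Inv (Model x f) where
  inv
    | ⟨u, k, false⟩ => ⟨-u, -k, false⟩
    | ⟨u, k, true⟩ => ⟨-u - f k - x, k, true⟩

theorem one_def : (1 : Model x f) = ⟨0, 0, false⟩ := rfl

@[simp] theorem even_mul (u v : B) (k l : ZMod n) (ε : Bool) :
    (⟨u, k, false⟩ * ⟨v, l, ε⟩ : Model x f) = ⟨u + v, k + l, ε⟩ := rfl

@[simp] theorem odd_mul_even (u v : B) (k l : ZMod n) :
    (⟨u, k, true⟩ * ⟨v, l, false⟩ : Model x f) = ⟨u + v + f l, k - l, true⟩ := rfl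

@[simp] theorem odd_mul_odd (u v : B) (k l : ZMod n) :
    (⟨u, k, true⟩ * ⟨v, l, true⟩ : Model x f) = ⟨u + v + f l + x, k - l, false⟩ := rfl

theorem even_inv (u : B) (k : ZMod n) : (⟨u, k, false⟩ : Model x f)⁻¹ = ⟨-u, -k, false⟩ := rfl

theorem odd_inv (u : B) (k : ZMod n) :
    (⟨u, k, true⟩ : Model x f)⁻¹ = ⟨-u - f k - x, k, true⟩ := rfl

instance : Group (Model x f) := Group.ofLeftAxioms
  (by
    rintro ⟨u, k, _ | _⟩ ⟨v, l, _ | _⟩ ⟨w, m, _ | _⟩ <;>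
      ext <;> simp <;> abel)
  (by rintro ⟨u, k, _ | _⟩ <;> ext <;> simp [one_def])
  (by
    rintro ⟨u, k, _ | _⟩ <;> ext <;> simp [one_def, even_inv, odd_inv]
    abel)

theorem even_pow (u : B) (k : ZMod n) (m : ℕ) :
    (⟨u, k, false⟩ : Model x f) ^ m = ⟨m • u, m • k, false⟩ := by
  induction m with
  | zero => simp [one_def]
  | succ m ih => rw [pow_succ, ih, even_mul, succ_nsmul, succ_nsmul]

theorem even_zpow (u : B) (k : ZMod n) (m : ℤ) :
    (⟨u, k, false⟩ : Model x f) ^ m = ⟨m • u, m • k, false⟩ := by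
  obtain ⟨m, rfl | rfl⟩ := m.eq_nat_or_neg
  · simp only [zpow_natCast, even_pow, natCast_zsmul]
  · simp only [zpow_neg, zpow_natCast, even_pow, even_inv, neg_smul, natCast_zsmul]

end Model

/-- To have `PQ = c`, `Q` must go to `P⁻¹c`, whose normal form is `y c⁻¹ P`. -/
theorem exists_model_hom (α β n : ℕ) :
    ∃ f : ZMod n →+ A α β n, f 1 = ((1, 1) : ℤ × ℤ) ∧
    ∃ φ : C (2 * α) (2 * β) n →* Model (((1, 0) : ℤ × ℤ) : A α β n) f,
      φ (P (2 * α) (2 * β) n) = ⟨0, 0, true⟩ ∧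
      φ (Q (2 * α) (2 * β) n) = ⟨((0, 1) : ℤ × ℤ), -1, true⟩ := by
  have hn : (n : ℤ) • (((1, 1) : ℤ × ℤ) : A α β n) = 0 := by
    rw [← QuotientAddGroup.mk_zsmul, Prod.smul_mk, mk_eq_zero_iff]
    exact ⟨1, 0, 0, by simp, by simp⟩
  have hα : α • (((1, 0) : ℤ × ℤ) : A α β n) = 0 := by
    rw [← QuotientAddGroup.mk_nsmul, Prod.smul_mk, mk_eq_zero_iff]
    exact ⟨0, 1, 0, by simp, by simp⟩
  have hβ : β • (((0, 1) : ℤ × ℤ) : A α β n) = 0 := by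
    rw [← QuotientAddGroup.mk_nsmul, Prod.smul_mk, mk_eq_zero_iff]
    exact ⟨0, 0, 1, by simp, by simp⟩
  have hadd : (((1, 1) : ℤ × ℤ) : A α β n) = ((1, 0) : ℤ × ℤ) + ((0, 1) : ℤ × ℤ) := by
    rw [← QuotientAddGroup.mk_add]; simp
  let f : ZMod n →+ A α β n :=
    ZMod.lift n ⟨zmultiplesHom _ (((1, 1) : ℤ × ℤ) : A α β n), by simpa using hn⟩
  have f1 : f 1 = ((1, 1) : ℤ × ℤ) := by
    have := ZMod.lift_coe n ⟨zmultiplesHom _ (((1, 1) : ℤ × ℤ) : A α β n), by simpa using hn⟩ 1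
    simpa using this
  have P2 : (⟨0, 0, true⟩ : Model (((1, 0) : ℤ × ℤ) : A α β n) f) ^ 2 =
      ⟨((1, 0) : ℤ × ℤ), 0, false⟩ := by
    simp [pow_two]
  have Q2 : (⟨((0, 1) : ℤ × ℤ), -1, true⟩ : Model (((1, 0) : ℤ × ℤ) : A α β n) f) ^ 2 =
      ⟨((0, 1) : ℤ × ℤ), 0, false⟩ := by
    rw [pow_two, Model.odd_mul_odd, map_neg, f1, hadd, sub_self]
    ext
    · simp
    · rfl
    · rfl
  refine ⟨f, f1, exists_hom _ _ ?_ ?_ ?_ ?_ ?_⟩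
  · rw [pow_mul, P2, Model.even_pow, hα, smul_zero, Model.one_def]
  · rw [pow_mul, Q2, Model.even_pow, hβ, smul_zero, Model.one_def]
  · rw [Model.odd_mul_odd, map_neg, f1, hadd, Model.even_pow, Model.one_def]
    ext
    · simp
    · simp
    · rfl
  · rw [P2]; ext <;> simp [add_comm]
  · rw [Q2]; ext <;> simp

/-- In the model `PQ` is `c` and `QP` is `c⁻¹` times `x + y`; compare components. -/
theorem commute_imp {α β n : ℕ}
    (h : P (2 * α) (2 * β) n * Q (2 * α) (2 * β) n = Q (2 * α) (2 * β) n * P (2 * α) (2 * β) n) :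
    n ∣ 2 ∧ (((1, 1) : ℤ × ℤ) : A α β n) = 0 := by
  obtain ⟨f, f1, φ, φP, φQ⟩ := exists_model_hom α β n
  have hadd : (((1, 1) : ℤ × ℤ) : A α β n) = ((0, 1) : ℤ × ℤ) + ((1, 0) : ℤ × ℤ) := by
    rw [← QuotientAddGroup.mk_add]; simp
  have h' := congrArg φ h
  rw [map_mul, map_mul, φP, φQ, Model.odd_mul_odd, Model.odd_mul_odd, map_neg, f1] at h'
  simp only [Model.mk.injEq, hadd, and_true, map_zero, sub_zero, zero_sub, neg_neg] at h'
  refine ⟨?_, ?_⟩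
  · rw [← ZMod.natCast_eq_zero_iff]
    push_cast
    linear_combination h'.2
  · rw [hadd]
    have := h'.1
    simp only [zero_add, add_zero] at this
    rw [← this]; abel

theorem zpow_mul_zpow_eq_one {α β n : ℕ} {z : ℤ × ℤ} (h : z ∈ lattice α β n) :
    (P (2 * α) (2 * β) n ^ 2) ^ z.1 * (Q (2 * α) (2 * β) n ^ 2) ^ z.2 = 1 := by
  obtain ⟨u, v, w, rfl⟩ := h
  set a := P (2 * α) (2 * β) n ^ 2 with ha
  set b := Q (2 * α) (2 * β) n ^ 2 with hb
  have hab : Commute a b := sq_P_commute _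
  have h1 : a ^ α = 1 := by rw [ha, ← pow_mul, P_pow]
  have h2 : b ^ β = 1 := by rw [hb, ← pow_mul, Q_pow]
  have h3 : a ^ n * b ^ n = 1 := by rw [ha, hb, ← pow_mul, ← pow_mul, P_pow_mul_Q_pow]
  change a ^ (u * n + v * α) * b ^ (u * n + w * β) = 1
  rw [zpow_add, zpow_add, mul_comm v, mul_comm w, mul_comm u, zpow_mul, zpow_mul, zpow_mul,
    zpow_mul]
  simp only [zpow_natCast, h1, h2, one_zpow, mul_one]
  rw [← (hab.pow_pow n n).mul_zpow, h3, one_zpow]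

theorem card_S (α β n : ℕ) : Nat.card (S (2 * α) (2 * β) n) = Nat.card (A α β n) := by
  obtain ⟨f, f1, φ, φP, φQ⟩ := exists_model_hom α β n
  set a := P (2 * α) (2 * β) n ^ 2 with ha
  set b := Q (2 * α) (2 * β) n ^ 2 with hb
  have hab : Commute a b := sq_P_commute _
  let ψ₀ : ℤ × ℤ →+ Additive (C (2 * α) (2 * β) n) :=
    { toFun := fun z ↦ Additive.ofMul (a ^ z.1 * b ^ z.2)
      map_zero' := by simp
      map_add' := by
        rintro ⟨i, j⟩ ⟨i', j'⟩
        rw [← ofMul_mul]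
        congr 1
        simp only [Prod.mk_add_mk, zpow_add]
        rw [mul_assoc, mul_assoc, ← mul_assoc (a ^ i'), (hab.zpow_zpow i' j).eq]
        simp only [mul_assoc] }
  have hψ₀ : lattice α β n ≤ ψ₀.ker := fun _ h ↦ zpow_mul_zpow_eq_one h
  let ψ : A α β n →+ Additive (C (2 * α) (2 * β) n) := QuotientAddGroup.lift _ ψ₀ hψ₀
  -- `φ` recovers the class `z` from its image in `S`, whence injectivity of `ψ`.
  have φψ (z : A α β n) : φ (ψ z).toMul = ⟨z, 0, false⟩ := by
    obtain ⟨⟨i, j⟩, rfl⟩ := QuotientAddGroup.mk_surjective z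
    change φ (a ^ i * b ^ j) = _
    have φa : φ a = ⟨((1, 0) : ℤ × ℤ), 0, false⟩ := by
      rw [ha, map_pow, φP, pow_two, Model.odd_mul_odd]; simp
    have φb : φ b = ⟨((0, 1) : ℤ × ℤ), 0, false⟩ := by
      rw [hb, map_pow, φQ, pow_two, Model.odd_mul_odd, map_neg, f1, sub_self]
      ext
      · rw [← QuotientAddGroup.mk_neg, ← QuotientAddGroup.mk_add, ← QuotientAddGroup.mk_add,
          ← QuotientAddGroup.mk_add]
        simp
      · rfl
      · rfl
    rw [map_mul, map_zpow, map_zpow, φa, φb, Model.even_zpow, Model.even_zpow, Model.even_mul,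
      ← QuotientAddGroup.mk_zsmul, ← QuotientAddGroup.mk_zsmul, ← QuotientAddGroup.mk_add]
    simp
  have hinj : Function.Injective ψ := fun z w h ↦ by
    have := φψ z
    rw [h, φψ w] at this
    exact (congrArg Model.u this).symm
  let Ψ : Multiplicative (A α β n) →* C (2 * α) (2 * β) n := AddMonoidHom.toMultiplicativeLeft ψ
  have hrange : Ψ.range = S (2 * α) (2 * β) n := by
    apply le_antisymm
    · rintro _ ⟨z, rfl⟩
      obtain ⟨⟨i, j⟩, hz⟩ := QuotientAddGroup.mk_surjective z.toAdd
      have : Ψ z = a ^ i * b ^ j := by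
        change (ψ z.toAdd).toMul = _
        rw [← hz]; rfl
      rw [this]
      exact mul_mem (zpow_mem (Subgroup.subset_closure (by simp [ha])) _)
        (zpow_mem (Subgroup.subset_closure (by simp [hb])) _)
    · rw [S, Subgroup.closure_le]
      rintro x (rfl | rfl)
      · refine ⟨.ofAdd ((1, 0) : ℤ × ℤ), ?_⟩
        change a ^ (1 : ℤ) * b ^ (0 : ℤ) = a
        simp
      · refine ⟨.ofAdd ((0, 1) : ℤ × ℤ), ?_⟩
        change a ^ (0 : ℤ) * b ^ (1 : ℤ) = b
        simp
  rw [← hrange]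
  exact (Nat.card_congr (Ψ.ofInjective hinj).toEquiv).symm

end Model

/-! ### Arithmetic of `p'`, `q'` and the excluded case -/

section Parity

variable {α β n : ℕ}

theorem reduced_two_mul : reduced (2 * α) (2 * β) n = 2 * Nat.gcd α (Nat.lcm n β) := by
  rw [reduced, Nat.lcm_mul_left, Nat.gcd_mul_left, Nat.lcm_comm]

theorem gcd_reduced_two_mul :
    Nat.gcd (reduced (2 * β) (2 * α) n) (2 * n) = 2 * Nat.gcd n β := by
  rw [reduced_two_mul, Nat.gcd_mul_left, Nat.gcd_assoc,
    Nat.gcd_eq_right (Nat.dvd_lcm_left n α), Nat.gcd_comm]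

theorem card_S_two_mul (hn : 0 < n) :
    Nat.card (S (2 * α) (2 * β) n) * 4 =
      reduced (2 * α) (2 * β) n * Nat.gcd (reduced (2 * β) (2 * α) n) (2 * n) := by
  rw [card_S, card_A hn, reduced_two_mul, gcd_reduced_two_mul]
  ring

theorem odd_gcd_lcm_two_iff : Odd (Nat.gcd α (Nat.lcm 2 β)) ↔ Odd α := by
  constructor
  · intro h
    by_contra h'
    rw [Nat.not_odd_iff_even, even_iff_two_dvd] at h'
    exact (Nat.not_even_iff_odd.mpr h)
      (even_iff_two_dvd.mpr (Nat.dvd_gcd h' (Nat.dvd_lcm_left 2 β)))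
  · exact fun h ↦ h.of_dvd_nat (Nat.gcd_dvd_left _ _)

/-- For `n = 2` the element `P ^ 2 * Q ^ 2` is trivial exactly in the excluded case. -/
theorem mk_one_one_eq_zero_iff : (((1, 1) : ℤ × ℤ) : A α β 2) = 0 ↔
    reduced (2 * α) (2 * β) 2 = reduced (2 * β) (2 * α) 2 ∧
      reduced (2 * α) (2 * β) 2 ≡ 2 [MOD 4] := by
  have hmod (m : ℕ) : 2 * m ≡ 2 [MOD 4] ↔ Odd m := by
    rw [Nat.ModEq, Nat.odd_iff]; omega
  rw [reduced_two_mul, reduced_two_mul, hmod, odd_gcd_lcm_two_iff, mk_eq_zero_iff]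
  -- For odd `α` the gcd is odd, so the factor 2 in the lcm is irrelevant.
  have key {α β : ℕ} (hα : Odd α) : Nat.gcd α (Nat.lcm 2 β) = Nat.gcd α β := by
    apply Nat.dvd_antisymm
    · refine Nat.dvd_gcd (Nat.gcd_dvd_left _ _) ?_
      have h2 : Nat.Coprime (Nat.gcd α (Nat.lcm 2 β)) 2 :=
        Nat.coprime_two_right.mpr (odd_gcd_lcm_two_iff.mpr hα)
      exact h2.dvd_of_dvd_mul_left ((Nat.gcd_dvd_right _ _).trans (Nat.lcm_dvd_mul 2 β))
    · exact Nat.gcd_dvd_gcd_of_dvd_right _ (Nat.dvd_lcm_right 2 β)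
  constructor
  · rintro ⟨u, v, w, h1, h2⟩
    have hα : Odd α := by
      by_contra h
      obtain ⟨k, rfl⟩ := even_iff_two_dvd.mp (Nat.not_odd_iff_even.mp h)
      push_cast at h1
      have : (2 : ℤ) ∣ 1 := ⟨u + v * k, by rw [h1]; ring⟩
      omega
    have hβ : Odd β := by
      by_contra h
      obtain ⟨k, rfl⟩ := even_iff_two_dvd.mp (Nat.not_odd_iff_even.mp h)
      push_cast at h2
      have : (2 : ℤ) ∣ 1 := ⟨u + w * k, by rw [h2]; ring⟩
      omega
    refine ⟨?_, hα⟩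
    rw [key hα, key hβ, Nat.gcd_comm]
  · rintro ⟨h, hα⟩
    have hβ : Odd β := by
      rw [← odd_gcd_lcm_two_iff (β := α), ← mul_left_cancel₀ two_ne_zero h]
      exact odd_gcd_lcm_two_iff.mpr hα
    obtain ⟨k, rfl⟩ := hα
    obtain ⟨l, rfl⟩ := hβ
    -- Taking `v = β`, `w = α` makes both equations `1 = 2u + αβ`, solvable since `αβ` is odd.
    refine ⟨-(k + l + 2 * k * l), 2 * l + 1, 2 * k + 1, ?_, ?_⟩ <;> push_cast <;> ring

/-- Here `P²Q² = 1`, so `QP = (PQ)⁻¹`, which is `PQ` because `(PQ)² = 1`. -/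
theorem commute_of_mk_one_one_eq_zero (h : (((1, 1) : ℤ × ℤ) : A α β 2) = 0) :
    P (2 * α) (2 * β) 2 * Q (2 * α) (2 * β) 2 = Q (2 * α) (2 * β) 2 * P (2 * α) (2 * β) 2 := by
  have hab : P (2 * α) (2 * β) 2 ^ 2 * Q (2 * α) (2 * β) 2 ^ 2 = 1 := by
    simpa using zpow_mul_zpow_eq_one ((QuotientAddGroup.eq_zero_iff _).mp h)
  rw [QP_eq, hab, mul_one, eq_inv_iff_mul_eq_one, ← pow_two, PQ_pow]

end Parity

end ChainGroup

/-! ### Assembly of both directions -/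

theorem theorem6 (p q n p' q' : ℕ) (hp : 0 < p) (hq : 0 < q) (hn : 0 < n)
    (hp' : p' = ChainGroup.reduced p q n) (hq' : q' = ChainGroup.reduced q p n) :
    (ChainGroup.P p q n * ChainGroup.Q p q n ≠ ChainGroup.Q p q n * ChainGroup.P p q n →
      Even p ∧ Even q ∧
      ChainGroup.P p q n ^ (2 * n) * ChainGroup.Q p q n ^ (2 * n) = 1 ∧
      (∃ e : ChainGroup.C p q n ≃* ChainGroup.C p' q' n,
        e (ChainGroup.P p q n) = ChainGroup.P p' q' n ∧
        e (ChainGroup.Q p q n) = ChainGroup.Q p' q' n) ∧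
      ¬ (n = 2 ∧ p' = q' ∧ p' ≡ 2 [MOD 4]) ∧
      Finite (ChainGroup.C p q n) ∧
      (Nat.card (ChainGroup.C p q n) : ℚ) = p' * Nat.gcd q' (2 * n) * n / 2 ∧
      IsMulCommutative (ChainGroup.S p q n) ∧
      ChainGroup.S p q n ≤ Subgroup.center (ChainGroup.C p q n) ∧
      (Nat.card (ChainGroup.S p q n) : ℚ) = p' * Nat.gcd q' (2 * n) / 4 ∧
      ∃ _ : (ChainGroup.S p q n).Normal,
        Nonempty (ChainGroup.C p q n ⧸ ChainGroup.S p q n ≃* DihedralGroup n)) ∧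
    (Even p → Even q → 2 ≤ n → ¬ (n = 2 ∧ p' = q' ∧ p' ≡ 2 [MOD 4]) →
      ChainGroup.P p q n * ChainGroup.Q p q n ≠ ChainGroup.Q p q n * ChainGroup.P p q n) := by
  subst hp' hq'
  constructor
  · intro h
    obtain ⟨hpe, hqe⟩ := ChainGroup.even_of_not_commute h
    obtain ⟨f, hf, hker⟩ := ChainGroup.exists_dihedral_hom (n := n) hpe hqe
    have hle := ChainGroup.S_le_center (p := p) (q := q) (n := n)
    have hnorm : (ChainGroup.S p q n).Normal := hker ▸ f.normal_ker
    have hS : Nat.card (ChainGroup.S p q n) * 4 = ChainGroup.reduced p q n *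
        Nat.gcd (ChainGroup.reduced q p n) (2 * n) := by
      obtain ⟨α, rfl⟩ := hpe.two_dvd
      obtain ⟨β, rfl⟩ := hqe.two_dvd
      exact ChainGroup.card_S_two_mul hn
    have hC : Nat.card (ChainGroup.C p q n) = Nat.card (ChainGroup.S p q n) * (2 * n) := by
      rw [← Subgroup.card_mul_index (ChainGroup.S p q n), ← hker, Subgroup.index_ker,
        MonoidHom.range_eq_top.mpr hf, Subgroup.card_top, DihedralGroup.nat_card]
    have hpos : 0 < ChainGroup.reduced p q n * Nat.gcd (ChainGroup.reduced q p n) (2 * n) :=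
      Nat.mul_pos (Nat.gcd_pos_of_pos_left _ hp) (Nat.gcd_pos_of_pos_right _ (by omega))
    have hSQ : (Nat.card (ChainGroup.S p q n) : ℚ) * 4 = ChainGroup.reduced p q n *
        Nat.gcd (ChainGroup.reduced q p n) (2 * n) := by exact_mod_cast hS
    refine ⟨hpe, hqe, ChainGroup.P_pow_mul_Q_pow, ChainGroup.exists_equiv_reduced, ?_, ?_, ?_,
      ?_, hle, ?_, hnorm, ?_⟩
    · rintro ⟨rfl, h1, h2⟩
      obtain ⟨α, rfl⟩ := hpe.two_dvd
      obtain ⟨β, rfl⟩ := hqe.two_dvd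
      exact h (ChainGroup.commute_of_mk_one_one_eq_zero
        (ChainGroup.mk_one_one_eq_zero_iff.mpr ⟨h1, h2⟩))
    · refine Nat.finite_of_card_ne_zero ?_
      rw [hC]
      exact (Nat.mul_pos (by omega) (by omega)).ne'
    · rw [hC]
      push_cast
      linear_combination (n : ℚ) / 2 * hSQ
    · exact ⟨⟨fun a b ↦ Subtype.ext (Subgroup.mem_center_iff.mp (hle b.2) a)⟩⟩
    · linear_combination hSQ / 4
    · exact ⟨(QuotientGroup.quotientMulEquivOfEq hker.symm).trans
        (QuotientGroup.quotientKerEquivOfSurjective f hf)⟩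
  · intro hpe hqe hn2 hne h
    obtain ⟨α, rfl⟩ := hpe.two_dvd
    obtain ⟨β, rfl⟩ := hqe.two_dvd
    obtain ⟨hdvd, h0⟩ := ChainGroup.commute_imp h
    obtain rfl : n = 2 := le_antisymm (Nat.le_of_dvd two_pos hdvd) hn2
    exact hne ⟨rfl, ChainGroup.mk_one_one_eq_zero_iff.mp h0⟩
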